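/- Let $e\ge 1$. An $e$-star $\{x;A\}$ is a complete bipartite graph $K_{1,e}$ with centre $x$ and a set $A$ of $e$ leaves. An $e$-star system of order $n$ is a set of $e$-stars (blocks) on an $n$-element vertex set $V$ whose edge sets partition the edge set of the complete graph on $V$. A $k$-colouring of the system is a map from $V$ to a set of $k$ colours such that no block has all its vertices of the same colour; the colour classes are the sets of vertices of a given colour. The system is $k$-chromatic if it has a $k$-colouring but no $(k-1)$-colouring. It is strongly equitable $k$-chromatic if it is $k$-chromatic and has a $k$-colouring whose $k$ colour classes all have the same size. It is uniquely $k$-chromatic if it is $k$-chromatic and has a $k$-colouring $\phi$ such that every $k$-colouring is obtained from $\phi$ by a permutation of the colours. Theorem. Let $k\ge 3$ and $e\ge 3$. If there exists a strongly equitable $k$-chromatic $e$-star system of some order $n_0\equiv 0 \pmod{2e}$, then there exists an $e$-star system of some order $n\equiv 0\pmod{2e}$ that is both strongly equitable $k$-chromatic and uniquely $k$-chromatic. -/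

import Mathlib

/-- An `e`-star `{x; A}` on vertices in `V`: the complete bipartite graph `K_{1,e}` with centre `x`
and edges `{x, a}` for `a` in the `e`-element set `A` of leaves. -/
@[ext]
structure EStar (V : Type*) (e : ℕ) where
  center : V
  leaves : Finset V
  card_leaves : leaves.card = e
  center_notMem : center ∉ leaves

namespace EStar

variable {V : Type*} {e : ℕ}

/-- The edge set of an `e`-star. -/
def edges (B : EStar V e) : Set (Sym2 V) :=
  {p | ∃ a ∈ B.leaves, p = s(B.center, a)}

/-- All vertices of the `e`-star receive the same colour under `φ`. -/
def IsMonochromatic {C : Type*} (B : EStar V e) (φ : V → C) : Prop :=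
  ∀ a ∈ B.leaves, φ a = φ B.center

end EStar

/-- An `e`-star system on `V`: a set of `e`-stars whose edge sets partition the edge set of the
complete graph on `V`. -/
structure EStarSystem (V : Type*) (e : ℕ) where
  blocks : Set (EStar V e)
  existsUnique_block : ∀ x y : V, x ≠ y → ∃! B : EStar V e, B ∈ blocks ∧ s(x, y) ∈ B.edges

namespace EStarSystem

variable {V : Type*} {e : ℕ}

/-- `φ` is a `k`-colouring of the system: no block is monochromatic. The colour classes are the
fibres of `φ`. -/
def IsColouring (S : EStarSystem V e) {k : ℕ} (φ : V → Fin k) : Prop :=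
  ∀ B ∈ S.blocks, ¬ B.IsMonochromatic φ

/-- The system admits a `k`-colouring. -/
def IsColourable (S : EStarSystem V e) (k : ℕ) : Prop :=
  ∃ φ : V → Fin k, S.IsColouring φ

/-- The system is `k`-colourable but not `(k-1)`-colourable (used for `k ≥ 1`). -/
def IsChromatic (S : EStarSystem V e) (k : ℕ) : Prop :=
  S.IsColourable k ∧ ¬ S.IsColourable (k - 1)

/-- The system admits a `k`-colouring whose colour classes all have the same size. -/
def HasStronglyEquitableColouring [Fintype V] (S : EStarSystem V e) (k : ℕ) : Prop :=
  ∃ φ : V → Fin k, S.IsColouring φ ∧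
    ∀ i j : Fin k, (Finset.univ.filter fun v => φ v = i).card =
      (Finset.univ.filter fun v => φ v = j).card

/-- The system has a `k`-colouring `φ` from which every `k`-colouring arises by permuting the
colours. -/
def IsUniquelyColourable (S : EStarSystem V e) (k : ℕ) : Prop :=
  ∃ φ : V → Fin k, S.IsColouring φ ∧
    ∀ ψ : V → Fin k, S.IsColouring ψ → ∃ σ : Equiv.Perm (Fin k), ψ = σ ∘ φ

end EStarSystem

open Finset

/-! Two systems T and S can be glued by splitting S into `e`-sets separately for each vertex x of T
and joining x to each set (`exists_glue`). Gluing copies of the given system makes every class of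
every `k`-colouring large (`exists_large_classes`).

Fix equitable colourings θ of T and φ of S, with classes of θ so large that inside each class i
every colouring ψ of S labels some vertex. The partition at such a vertex has no set inside φ-class
i, so θ and φ together remain a colouring. It has a set inside every other φ-class, and also inside
every ψ-class unless some ψ-class lies in φ-class i (`exists_blocking_ePartition`). In the latter
blocks, ψ leaves no colour for the vertex. Hence a surviving ψ has a class inside each φ-class, so
it is φ up to a permutation σ, and the sets inside the other φ-classes then force θ up to the same
σ. -/

/-! ### Partitions into `e`-sets -/

/-- A block family partitions `R` into `e`-sets. -/
def IsEPartition {α : Type*} (e : ℕ) (P : Finset (Finset α)) (R : Finset α) : Prop :=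
  (∀ A ∈ P, A.card = e ∧ A ⊆ R) ∧ ∀ w ∈ R, ∃! A, A ∈ P ∧ w ∈ A

/-- A set of size `e * m` splits into `e`-sets each of which meets a given subset `D` with at least
`m` elements. -/
theorem exists_ePartition_meeting {α : Type*} [DecidableEq α] {e : ℕ} (he : 1 ≤ e) (m : ℕ) :
    ∀ R D : Finset α, D ⊆ R → R.card = e * m → m ≤ D.card →
      ∃ P, IsEPartition e P R ∧ ∀ A ∈ P, ∃ a ∈ A, a ∈ D := by
  induction m with
  | zero =>
    intro R D _ hR _
    have : R = ∅ := by simpa using hR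
    subst this
    exact ⟨∅, ⟨by simp, by simp⟩, by simp⟩
  | succ m ih =>
    intro R D hDR hR hD
    -- Only `m + 1` marked points are kept; each set uses one and is filled up from outside `D'`, so
    -- none runs short.
    obtain ⟨D', hD'D, hD'⟩ := exists_subset_card_eq hD
    have hne : D'.Nonempty := card_pos.mp (by omega)
    obtain ⟨d, hd⟩ := hne
    have hRD' : (R \ D').card = e * (m + 1) - (m + 1) := by
      rw [card_sdiff_of_subset (hD'D.trans hDR), hR, hD']
    have hbig : e - 1 ≤ (R \ D').card := by
      rw [hRD']
      obtain ⟨f, rfl⟩ : ∃ f, e = f + 1 := ⟨e - 1, by omega⟩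
      have : (f + 1) * (m + 1) = f * m + f + (m + 1) := by ring
      rw [this]
      have := Nat.zero_le (f * m)
      omega
    obtain ⟨Q, hQ, hQc⟩ := exists_subset_card_eq hbig
    have hdQ : d ∉ Q := fun h => (mem_sdiff.mp (hQ h)).2 hd
    set A := insert d Q with hA
    have hAc : A.card = e := by rw [hA, card_insert_of_notMem hdQ, hQc]; omega
    have hAR : A ⊆ R := by
      intro x hx
      rcases mem_insert.mp hx with rfl | hx
      · exact hDR (hD'D hd)
      · exact (mem_sdiff.mp (hQ hx)).1
    have hsub : D'.erase d ⊆ R \ A := by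
      intro x hx
      have hx' := mem_erase.mp hx
      refine mem_sdiff.mpr ⟨hDR (hD'D hx'.2), fun h => ?_⟩
      rcases mem_insert.mp h with h | h
      · exact hx'.1 h
      · exact (mem_sdiff.mp (hQ h)).2 hx'.2
    obtain ⟨P, ⟨hP1, hP2⟩, hP3⟩ := ih (R \ A) (D'.erase d) hsub
      (by rw [card_sdiff_of_subset hAR, hR, hAc, mul_add, mul_one, Nat.add_sub_cancel])
      (by rw [card_erase_of_mem hd]; omega)
    refine ⟨insert A P, ⟨?_, ?_⟩, ?_⟩
    · intro B hB
      rcases mem_insert.mp hB with rfl | hB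
      · exact ⟨hAc, hAR⟩
      · exact ⟨(hP1 B hB).1, (hP1 B hB).2.trans sdiff_subset⟩
    · intro w hw
      by_cases hwA : w ∈ A
      · refine ⟨A, ⟨mem_insert_self _ _, hwA⟩, ?_⟩
        rintro B ⟨hB, hwB⟩
        rcases mem_insert.mp hB with rfl | hB
        · rfl
        · exact absurd hwA (mem_sdiff.mp ((hP1 B hB).2 hwB)).2
      · obtain ⟨B, ⟨hB, hwB⟩, huniq⟩ := hP2 w (mem_sdiff.mpr ⟨hw, hwA⟩)
        refine ⟨B, ⟨mem_insert_of_mem hB, hwB⟩, ?_⟩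
        rintro B' ⟨hB', hwB'⟩
        rcases mem_insert.mp hB' with rfl | hB'
        · exact absurd hwB' hwA
        · exact huniq B' ⟨hB', hwB'⟩
    · intro B hB
      rcases mem_insert.mp hB with rfl | hB
      · exact ⟨d, mem_insert_self _ _, hD'D hd⟩
      · obtain ⟨a, haB, ha⟩ := hP3 B hB
        exact ⟨a, haB, hD'D (mem_of_mem_erase ha)⟩

/-- A family of disjoint `e`-sets, none contained in `C`, extends to a partition of the whole type
into `e`-sets, none contained in `C`, as long as the complement of `C` is large. -/
theorem exists_ePartition_extending {α : Type*} [Fintype α] [DecidableEq α] {e : ℕ} (he : 1 ≤ e)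
    (hα : e ∣ Fintype.card α) (C : Finset α) (Q : Finset (Finset α))
    (hQcard : ∀ A ∈ Q, A.card = e) (hQdisj : ∀ A ∈ Q, ∀ B ∈ Q, ∀ w, w ∈ A → w ∈ B → A = B)
    (hQC : ∀ A ∈ Q, ∃ a ∈ A, a ∉ C)
    (hbig : Fintype.card α + e * (e * Q.card) ≤ e * Cᶜ.card) :
    ∃ P : Finset (Finset α), Q ⊆ P ∧ IsEPartition e P univ ∧ ∀ A ∈ P, ∃ a ∈ A, a ∉ C := by
  have hU : (Q.biUnion id).card = e * Q.card := by
    rw [card_biUnion]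
    · simp only [id_eq]
      rw [sum_congr rfl hQcard, sum_const, smul_eq_mul, mul_comm]
    · intro A hA B hB hne
      exact disjoint_left.mpr fun w hwA hwB => hne (hQdisj A hA B hB w hwA hwB)
  set U := Q.biUnion id with hUdef
  have hR : Uᶜ.card = Fintype.card α - e * Q.card := by rw [card_compl, hU]
  have hdvd : e ∣ Uᶜ.card := hR ▸ Nat.dvd_sub hα (dvd_mul_right _ _)
  obtain ⟨m, hm⟩ := hdvd
  have hD : m ≤ (Cᶜ \ U).card := by
    have h1 : Cᶜ.card ≤ (Cᶜ \ U).card + e * Q.card := by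
      rw [← hU]; exact card_le_card_sdiff_add_card
    have h2 : e * m ≤ Fintype.card α := by rw [← hm]; exact card_le_univ _
    have h3 : e * Cᶜ.card ≤ e * (Cᶜ \ U).card + e * (e * Q.card) := by
      rw [← mul_add]; exact Nat.mul_le_mul_left _ h1
    have h4 : e * m ≤ e * (Cᶜ \ U).card := by omega
    exact Nat.le_of_mul_le_mul_left h4 he
  obtain ⟨P, ⟨hP1, hP2⟩, hP3⟩ := exists_ePartition_meeting he m Uᶜ (Cᶜ \ U)
    (fun x hx => mem_compl.mpr (mem_sdiff.mp hx).2) hm hD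
  have hPU : ∀ A ∈ P, ∀ w ∈ A, w ∉ U := fun A hA w hw => mem_compl.mp ((hP1 A hA).2 hw)
  have hQU : ∀ A ∈ Q, ∀ w ∈ A, w ∈ U := fun A hA w hw => mem_biUnion.mpr ⟨A, hA, hw⟩
  refine ⟨Q ∪ P, subset_union_left, ⟨?_, ?_⟩, ?_⟩
  · intro A hA
    rcases mem_union.mp hA with hA | hA
    · exact ⟨hQcard A hA, subset_univ _⟩
    · exact ⟨(hP1 A hA).1, subset_univ _⟩
  · intro w _
    by_cases hw : w ∈ U
    · obtain ⟨A, hA, hwA⟩ := mem_biUnion.mp hw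
      refine ⟨A, ⟨mem_union_left _ hA, hwA⟩, ?_⟩
      rintro B ⟨hB, hwB⟩
      rcases mem_union.mp hB with hB | hB
      · exact hQdisj B hB A hA w hwB hwA
      · exact absurd hw (hPU B hB w hwB)
    · obtain ⟨A, ⟨hA, hwA⟩, huniq⟩ := hP2 w (mem_compl.mpr hw)
      refine ⟨A, ⟨mem_union_right _ hA, hwA⟩, ?_⟩
      rintro B ⟨hB, hwB⟩
      rcases mem_union.mp hB with hB | hB
      · exact absurd (hQU B hB w hwB) hw
      · exact huniq B ⟨hB, hwB⟩
  · intro A hA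
    rcases mem_union.mp hA with hA | hA
    · exact hQC A hA
    · obtain ⟨a, haA, ha⟩ := hP3 A hA
      exact ⟨a, haA, mem_compl.mp (mem_sdiff.mp ha).1⟩

/-! ### Gluing star systems -/

namespace EStar

variable {V V' : Type*} {e : ℕ}

/-- The image of a star under an embedding of the vertex set. -/
def map (f : V ↪ V') (B : EStar V e) : EStar V' e where
  center := f B.center
  leaves := B.leaves.map f
  card_leaves := by rw [card_map, B.card_leaves]
  center_notMem := by
    rw [mem_map']
    exact B.center_notMem

theorem mk_mem_edges {B : EStar V e} {x y : V} :
    s(x, y) ∈ B.edges ↔ (x = B.center ∧ y ∈ B.leaves) ∨ (y = B.center ∧ x ∈ B.leaves) := by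
  simp only [edges, Set.mem_ofPred_eq, Sym2.eq_iff]
  constructor
  · rintro ⟨a, ha, ⟨rfl, rfl⟩ | ⟨rfl, rfl⟩⟩
    · exact Or.inl ⟨rfl, ha⟩
    · exact Or.inr ⟨rfl, ha⟩
  · rintro (⟨rfl, h⟩ | ⟨rfl, h⟩)
    · exact ⟨y, h, Or.inl ⟨rfl, rfl⟩⟩
    · exact ⟨x, h, Or.inr ⟨rfl, rfl⟩⟩

theorem mk_mem_edges_map (f : V ↪ V') (B : EStar V e) (x y : V) :
    s(f x, f y) ∈ (B.map f).edges ↔ s(x, y) ∈ B.edges := by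
  simp [mk_mem_edges, map]

theorem exists_of_mk_mem_edges_map {f : V ↪ V'} {B : EStar V e} {x y : V'}
    (h : s(x, y) ∈ (B.map f).edges) : (∃ a, f a = x) ∧ ∃ b, f b = y := by
  rcases mk_mem_edges.mp h with ⟨hx, hy⟩ | ⟨hx, hy⟩ <;>
    obtain ⟨a, -, ha⟩ := mem_map.mp hy
  · exact ⟨⟨_, hx.symm⟩, ⟨a, ha⟩⟩
  · exact ⟨⟨a, ha⟩, ⟨_, hx.symm⟩⟩

theorem isMonochromatic_map {C : Type*} (f : V ↪ V') (B : EStar V e) (φ : V' → C) :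
    (B.map f).IsMonochromatic φ ↔ B.IsMonochromatic (φ ∘ f) := by
  simp [IsMonochromatic, map]

end EStar

namespace EStarSystem

/-- Two star systems combine to one on the disjoint union of their vertex sets, whose crossing
blocks are centred in the first part, once the second part is split into `e`-sets for every vertex
of the first. -/
theorem exists_glue {e m n : ℕ} (S : EStarSystem (Fin m) e) (T : EStarSystem (Fin n) e)
    (p : Fin m → Finset (Finset (Fin n))) (hp : ∀ x, IsEPartition e (p x) univ) :
    ∃ U : EStarSystem (Fin (m + n)) e, ∀ (k : ℕ) (φ : Fin (m + n) → Fin k),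
      U.IsColouring φ ↔ S.IsColouring (φ ∘ Fin.castAdd n) ∧ T.IsColouring (φ ∘ Fin.natAdd m) ∧
        ∀ x, ∀ A ∈ p x, ∃ a ∈ A, φ (Fin.natAdd m a) ≠ φ (Fin.castAdd n x) := by
  have hne : ∀ (x : Fin m) (y : Fin n), Fin.castAdd n x ≠ Fin.natAdd m y := by
    intro x y h
    have := congrArg Fin.val h
    simp at this
    omega
  let f : Fin m ↪ Fin (m + n) := ⟨Fin.castAdd n, Fin.castAdd_injective m n⟩
  let g : Fin n ↪ Fin (m + n) := ⟨Fin.natAdd m, Fin.natAdd_injective n m⟩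
  have hfg : ∀ x y, f x ≠ g y := hne
  let cross : ∀ (x : Fin m) (A : Finset (Fin n)), A ∈ p x → EStar (Fin (m + n)) e :=
    fun x A hA =>
      { center := f x
        leaves := A.map g
        card_leaves := by rw [card_map, ((hp x).1 A hA).1]
        center_notMem := by
          intro h
          obtain ⟨a, -, ha⟩ := mem_map.mp h
          exact hfg x a ha.symm }
  let blocks : Set (EStar (Fin (m + n)) e) :=
    {B | (∃ B' ∈ S.blocks, B = B'.map f) ∨ (∃ B' ∈ T.blocks, B = B'.map g) ∨
      ∃ x A, ∃ hA : A ∈ p x, B = cross x A hA}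
  have hcross : ∀ x y, ∃! B, B ∈ blocks ∧ s(f x, g y) ∈ B.edges := by
    intro x y
    obtain ⟨A, ⟨hA, hyA⟩, huniq⟩ := (hp x).2 y (mem_univ _)
    refine ⟨cross x A hA, ⟨Or.inr (Or.inr ⟨x, A, hA, rfl⟩),
      EStar.mk_mem_edges.mpr (Or.inl ⟨rfl, mem_map_of_mem g hyA⟩)⟩, ?_⟩
    rintro B ⟨⟨B', -, rfl⟩ | ⟨B', -, rfl⟩ | ⟨x', A', hA', rfl⟩, hB⟩
    · obtain ⟨-, b, hb⟩ := EStar.exists_of_mk_mem_edges_map hB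
      exact absurd hb (hfg _ _)
    · obtain ⟨⟨b, hb⟩, -⟩ := EStar.exists_of_mk_mem_edges_map hB
      exact absurd hb.symm (hfg _ _)
    · rcases EStar.mk_mem_edges.mp hB with ⟨hc, hl⟩ | ⟨hc, -⟩
      · have hx : x = x' := f.injective hc
        subst hx
        have : A' = A := huniq A' ⟨hA', (mem_map' g).mp hl⟩
        subst this
        rfl
      · exact absurd hc.symm (hfg _ _)
  refine ⟨⟨blocks, ?_⟩, ?_⟩
  · intro u v
    refine Fin.addCases (fun x => ?_) (fun x => ?_) u <;>
      refine Fin.addCases (fun y => ?_) (fun y => ?_) v <;> intro huv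
    · obtain ⟨B, ⟨hB, hxy⟩, huniq⟩ := S.existsUnique_block x y fun h => huv (by rw [h])
      refine ⟨B.map f, ⟨Or.inl ⟨B, hB, rfl⟩, (EStar.mk_mem_edges_map f B x y).mpr hxy⟩, ?_⟩
      rintro B₁ ⟨⟨B', hB', rfl⟩ | ⟨B', -, rfl⟩ | ⟨x', A', hA', rfl⟩, hB₁⟩
      · rw [huniq B' ⟨hB', (EStar.mk_mem_edges_map f B' x y).mp hB₁⟩]
      · obtain ⟨⟨b, hb⟩, -⟩ := EStar.exists_of_mk_mem_edges_map hB₁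
        exact absurd hb.symm (hfg _ _)
      · rcases EStar.mk_mem_edges.mp hB₁ with ⟨-, hl⟩ | ⟨-, hl⟩ <;>
          obtain ⟨a, -, ha⟩ := mem_map.mp hl <;> exact absurd ha.symm (hfg _ _)
    · exact hcross x y
    · have := hcross y x
      rwa [Sym2.eq_swap] at this
    · obtain ⟨B, ⟨hB, hxy⟩, huniq⟩ := T.existsUnique_block x y fun h => huv (by rw [h])
      refine ⟨B.map g, ⟨Or.inr (Or.inl ⟨B, hB, rfl⟩), (EStar.mk_mem_edges_map g B x y).mpr hxy⟩, ?_⟩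
      rintro B₁ ⟨⟨B', -, rfl⟩ | ⟨B', hB', rfl⟩ | ⟨x', A', hA', rfl⟩, hB₁⟩
      · obtain ⟨⟨b, hb⟩, -⟩ := EStar.exists_of_mk_mem_edges_map hB₁
        exact absurd hb (hfg _ _)
      · rw [huniq B' ⟨hB', (EStar.mk_mem_edges_map g B' x y).mp hB₁⟩]
      · rcases EStar.mk_mem_edges.mp hB₁ with ⟨hc, -⟩ | ⟨hc, -⟩ <;> exact absurd hc.symm (hfg _ _)
  · intro k φ
    constructor
    · intro h
      refine ⟨fun B hB hmono => ?_, fun B hB hmono => ?_, fun x A hA => ?_⟩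
      · exact h (B.map f) (Or.inl ⟨B, hB, rfl⟩) ((EStar.isMonochromatic_map f B φ).mpr hmono)
      · exact h (B.map g) (Or.inr (Or.inl ⟨B, hB, rfl⟩))
          ((EStar.isMonochromatic_map g B φ).mpr hmono)
      · by_contra! hcon
        refine h (cross x A hA) (Or.inr (Or.inr ⟨x, A, hA, rfl⟩)) fun b hb => ?_
        obtain ⟨a, ha, rfl⟩ := mem_map.mp hb
        exact hcon a ha
    · rintro ⟨hS, hT, hc⟩ B (⟨B', hB', rfl⟩ | ⟨B', hB', rfl⟩ | ⟨x, A, hA, rfl⟩) hmono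
      · exact hS B' hB' ((EStar.isMonochromatic_map f B' φ).mp hmono)
      · exact hT B' hB' ((EStar.isMonochromatic_map g B' φ).mp hmono)
      · obtain ⟨a, ha, hne'⟩ := hc x A hA
        exact hne' (hmono (g a) (mem_map_of_mem g ha))

/-- A colouring of a system without a `(k-1)`-colouring uses every one of its `k` colours. -/
theorem IsColouring.surjective {V : Type*} {e k : ℕ} {S : EStarSystem V e}
    (hS : ¬ S.IsColourable (k - 1)) {φ : V → Fin k} (hφ : S.IsColouring φ) :
    Function.Surjective φ := by
  intro c
  by_contra! hc
  obtain ⟨k, rfl⟩ : ∃ k', k = k' + 1 := ⟨k - 1, by have := c.pos; omega⟩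
  -- Deleting the unused colour `c` leaves a colouring with one colour fewer.
  choose χ hχ using fun v => Fin.exists_succAbove_eq (hc v)
  refine hS ⟨χ, fun B hB hmono => hφ B hB fun a ha => ?_⟩
  rw [← hχ a, ← hχ, hmono a ha]

/-! ### Sizes of colour classes -/

/-- The number of vertices of a given colour. -/
def classCard {n k : ℕ} (φ : Fin n → Fin k) (c : Fin k) : ℕ :=
  (univ.filter fun v => φ v = c).card

theorem classCard_add {m n k : ℕ} (φ : Fin (m + n) → Fin k) (c : Fin k) :
    classCard φ c = classCard (φ ∘ Fin.castAdd n) c + classCard (φ ∘ Fin.natAdd m) c := by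
  simp only [classCard, card_filter, Fin.sum_univ_add, Function.comp_apply]

theorem mul_classCard {n k : ℕ} {φ : Fin n → Fin k} (hφ : ∀ i j, classCard φ i = classCard φ j)
    (i : Fin k) : k * classCard φ i = n := by
  have h := card_eq_sum_card_fiberwise (f := φ) (s := univ) (t := univ) (fun _ _ => by simp)
  change _ = ∑ j, classCard φ j at h
  rw [card_univ, Fintype.card_fin, sum_congr rfl (fun j _ => hφ j i)] at h
  simpa using h.symm

theorem card_compl_class {n k : ℕ} {φ : Fin n → Fin k}
    (hφ : ∀ i j, classCard φ i = classCard φ j) (i : Fin k) :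
    (univ.filter fun v => φ v = i)ᶜ.card = (k - 1) * classCard φ i := by
  rw [card_compl, Fintype.card_fin, Nat.sub_mul, mul_classCard hφ, one_mul]
  rfl

theorem append_comp_castAdd {m n k : ℕ} (φ : Fin m → Fin k) (ψ : Fin n → Fin k) :
    Fin.append φ ψ ∘ Fin.castAdd n = φ := by ext x; simp

theorem append_comp_natAdd {m n k : ℕ} (φ : Fin m → Fin k) (ψ : Fin n → Fin k) :
    Fin.append φ ψ ∘ Fin.natAdd m = ψ := by ext x; simp

/-- Repeating a system that is not `(k-1)`-colourable makes all classes of all `k`-colourings as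
large as required. -/
theorem exists_large_classes {e k n₀ : ℕ} (hk : 3 ≤ k) (he : 3 ≤ e) (hn₀ : 2 * e ∣ n₀)
    (S₀ : EStarSystem (Fin n₀) e) (hS₀ : ¬ S₀.IsColourable (k - 1)) (φ₀ : Fin n₀ → Fin k)
    (hφ₀ : S₀.IsColouring φ₀) (heq₀ : ∀ i j, classCard φ₀ i = classCard φ₀ j) (t : ℕ) :
    ∃ (n : ℕ) (S : EStarSystem (Fin n) e) (φ : Fin n → Fin k), 2 * e ∣ n ∧ S.IsColouring φ ∧
      (∀ i j, classCard φ i = classCard φ j) ∧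
      ∀ ψ : Fin n → Fin k, S.IsColouring ψ → ∀ c, t ≤ classCard ψ c := by
  induction t with
  | zero =>
    exact ⟨n₀, S₀, φ₀, hn₀, hφ₀, heq₀, fun _ _ _ => Nat.zero_le _⟩
  | succ t ih =>
    obtain ⟨n, S, φ, hn, hφ, heq, hbig⟩ := ih
    have hpart : ∀ x : Fin n₀, ∃ P : Finset (Finset (Fin n)), IsEPartition e P univ ∧
        ∀ A ∈ P, ∃ a ∈ A, φ a ≠ φ₀ x := by
      intro x
      obtain ⟨P, -, hP, hPC⟩ := exists_ePartition_extending (by omega : 1 ≤ e)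
        (by rw [Fintype.card_fin]; exact (dvd_mul_left e 2).trans hn)
        (univ.filter fun v => φ v = φ₀ x) ∅ (by simp) (by simp) (by simp) (by
          rw [card_compl_class heq, Fintype.card_fin, card_empty, mul_zero, mul_zero, add_zero,
            ← mul_assoc]
          conv_lhs => rw [← mul_classCard heq (φ₀ x)]
          refine Nat.mul_le_mul_right _ ?_
          calc k ≤ 3 * (k - 1) := by omega
            _ ≤ e * (k - 1) := Nat.mul_le_mul_right _ he)
      exact ⟨P, hP, fun A hA => by simpa using hPC A hA⟩
    choose p hp hpC using hpart
    obtain ⟨U, hU⟩ := exists_glue S₀ S p hp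
    refine ⟨n₀ + n, U, Fin.append φ₀ φ, dvd_add hn₀ hn, ?_, ?_, ?_⟩
    · rw [hU, append_comp_castAdd, append_comp_natAdd]
      exact ⟨hφ₀, hφ, fun x A hA => by simpa using hpC x A hA⟩
    · intro i j
      rw [classCard_add, classCard_add, append_comp_castAdd, append_comp_natAdd, heq₀ i j, heq i j]
    · intro ψ hψ c
      obtain ⟨h₀, h₁, -⟩ := (hU k ψ).mp hψ
      -- The new copy of `S₀` adds at least one vertex of every colour.
      obtain ⟨v, hv⟩ := h₀.surjective hS₀ c
      have : 0 < classCard (ψ ∘ Fin.castAdd n) c := card_pos.mpr ⟨v, by simpa using hv⟩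
      have := hbig _ h₁ c
      rw [classCard_add]
      omega

/-! ### Forcing and blocking colourings -/

/-- If every class of `φ` contains a class of the surjection `ψ`, then both have the same
classes. -/
theorem exists_perm_of_class_subset {V : Type*} {k : ℕ} {φ ψ : V → Fin k}
    (hψ : Function.Surjective ψ) (h : ∀ i, ∃ c, ∀ v, ψ v = c → φ v = i) :
    ∃ σ : Equiv.Perm (Fin k), ψ = σ ∘ φ := by
  choose c hc using h
  have hinj : Function.Injective c := by
    intro i j hij
    obtain ⟨v, hv⟩ := hψ (c i)
    rw [← hc i v hv, hc j v (hv.trans hij)]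
  refine ⟨Equiv.ofBijective c (Finite.injective_iff_bijective.mp hinj), funext fun v => ?_⟩
  obtain ⟨i, hi⟩ := Finite.surjective_of_injective hinj (ψ v)
  rw [Function.comp_apply, Equiv.ofBijective_apply, hc i v hi.symm, hi]

/-- Given disjoint `e`-sets, at most `k` of them and none inside the class `i`, there is a partition
into `e`-sets that extends them, has no set inside the class `i`, and has a set inside every other
class. -/
theorem exists_forcing_ePartition {e k n : ℕ} (hk : 3 ≤ k) (he : 3 ≤ e) (hn : e ∣ n)
    {φ : Fin n → Fin k} (heq : ∀ i j, classCard φ i = classCard φ j)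
    (hbig : ∀ c, 2 * k * e ≤ classCard φ c) (i : Fin k) (Q : Finset (Finset (Fin n)))
    (hQk : Q.card ≤ k) (hQcard : ∀ A ∈ Q, A.card = e)
    (hQdisj : ∀ A ∈ Q, ∀ B ∈ Q, ∀ w, w ∈ A → w ∈ B → A = B)
    (hQC : ∀ A ∈ Q, ∃ a ∈ A, φ a ≠ i) :
    ∃ P : Finset (Finset (Fin n)), Q ⊆ P ∧ IsEPartition e P univ ∧
      (∀ A ∈ P, ∃ a ∈ A, φ a ≠ i) ∧ ∀ c, c ≠ i → ∃ A ∈ P, ∀ a ∈ A, φ a = c := by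
  have hU : (Q.biUnion id).card ≤ k * e := by
    refine (card_biUnion_le_card_mul Q id e fun A hA => (hQcard A hA).le).trans ?_
    exact Nat.mul_le_mul_right _ hQk
  -- `Q` covers at most `k * e` of the at least `2 * k * e` vertices of class `c`.
  have hF : ∀ c, ∃ F : Finset (Fin n), F ⊆ (univ.filter fun v => φ v = c) \ Q.biUnion id ∧
      F.card = e := by
    intro c
    refine exists_subset_card_eq ?_
    have h1 := card_le_card_sdiff_add_card (t := Q.biUnion id) (s := univ.filter fun v => φ v = c)
    have h2 : 2 * k * e ≤ (univ.filter fun v => φ v = c).card := hbig c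
    have h3 : e ≤ k * e := Nat.le_mul_of_pos_left _ (by omega)
    have h4 : 2 * k * e = k * e + k * e := by ring
    omega
  choose F hFsub hFcard using hF
  have hFφ : ∀ c, ∀ a ∈ F c, φ a = c := fun c a ha => by
    simpa using (mem_sdiff.mp (hFsub c ha)).1
  have hFQ : ∀ c, ∀ a ∈ F c, ∀ A ∈ Q, a ∉ A := fun c a ha A hA haA =>
    (mem_sdiff.mp (hFsub c ha)).2 (mem_biUnion.mpr ⟨A, hA, haA⟩)
  set Q' := Q ∪ (univ.erase i).image F with hQ'
  have hQ'card : Q'.card ≤ 2 * k - 1 := by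
    have h1 : Q'.card ≤ Q.card + ((univ.erase i).image F).card := card_union_le _ _
    have h2 : ((univ.erase i).image F).card ≤ k - 1 := by
      refine card_image_le.trans ?_
      rw [card_erase_of_mem (mem_univ _), card_univ, Fintype.card_fin]
    omega
  obtain ⟨P, hQP, hP, hPC⟩ := exists_ePartition_extending (by omega : 1 ≤ e)
    (by rwa [Fintype.card_fin]) (univ.filter fun v => φ v = i) Q' (by
      intro A hA
      rcases mem_union.mp hA with hA | hA
      · exact hQcard A hA
      · obtain ⟨c, -, rfl⟩ := mem_image.mp hA
        exact hFcard c) (by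
      intro A hA B hB w hwA hwB
      rcases mem_union.mp hA with hA | hA <;> rcases mem_union.mp hB with hB | hB
      · exact hQdisj A hA B hB w hwA hwB
      · obtain ⟨c, -, rfl⟩ := mem_image.mp hB
        exact absurd hwA (hFQ c w hwB A hA)
      · obtain ⟨c, -, rfl⟩ := mem_image.mp hA
        exact absurd hwB (hFQ c w hwA B hB)
      · obtain ⟨c, -, rfl⟩ := mem_image.mp hA
        obtain ⟨d, -, rfl⟩ := mem_image.mp hB
        rw [← hFφ c w hwA, hFφ d w hwB]) (by
      intro A hA
      rcases mem_union.mp hA with hA | hA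
      · simpa using hQC A hA
      · obtain ⟨c, hc, rfl⟩ := mem_image.mp hA
        obtain ⟨a, ha⟩ : (F c).Nonempty := card_pos.mp (by rw [hFcard]; omega)
        exact ⟨a, ha, by simpa [hFφ c a ha] using (mem_erase.mp hc).1⟩) (by
      rw [card_compl_class heq, Fintype.card_fin]
      have hn' := mul_classCard heq i
      have hs := hbig i
      set s := classCard φ i
      have h1 : e * (e * Q'.card) ≤ e * s := by
        refine Nat.mul_le_mul_left _ (le_trans ?_ hs)
        rw [mul_comm (2 * k)]
        exact Nat.mul_le_mul_left _ (by omega)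
      -- The count needs both `3 ≤ k` and `3 ≤ e`; equality holds at `k = e = 3`.
      have h2 : k + e ≤ e * (k - 1) := by
        obtain ⟨j, rfl⟩ : ∃ j, k = j + 3 := ⟨k - 3, by omega⟩
        have : e * (j + 3 - 1) = e * j + 2 * e := by
          rw [show j + 3 - 1 = j + 2 by omega]; ring
        have : 3 * j ≤ e * j := Nat.mul_le_mul_right _ he
        omega
      calc n + e * (e * Q'.card) ≤ k * s + e * s := by omega
        _ = (k + e) * s := by ring
        _ ≤ e * (k - 1) * s := Nat.mul_le_mul_right _ h2
        _ = e * ((k - 1) * s) := by ring)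
  refine ⟨P, subset_union_left.trans hQP, hP, fun A hA => by simpa using hPC A hA, ?_⟩
  intro c hc
  exact ⟨F c, hQP (mem_union_right _ (mem_image_of_mem _ (mem_erase.mpr ⟨hc, mem_univ _⟩))),
    hFφ c⟩

/-- If no class of `ψ` lies inside the class `i` of `φ`, then there is a partition as in
`exists_forcing_ePartition` that also has a set inside every class of `ψ`. -/
theorem exists_blocking_ePartition {e k n : ℕ} (hk : 3 ≤ k) (he : 3 ≤ e) (hn : e ∣ n)
    {φ : Fin n → Fin k} (heq : ∀ i j, classCard φ i = classCard φ j)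
    (hbig : ∀ c, 2 * k * e ≤ classCard φ c) (i : Fin k) (ψ : Fin n → Fin k)
    (hψ : ∀ c, e ≤ classCard ψ c) :
    ∃ P : Finset (Finset (Fin n)), IsEPartition e P univ ∧
      (∀ A ∈ P, ∃ a ∈ A, φ a ≠ i) ∧ (∀ c, c ≠ i → ∃ A ∈ P, ∀ a ∈ A, φ a = c) ∧
      ((∀ c, ∃ v, ψ v = c ∧ φ v ≠ i) → ∀ c, ∃ A ∈ P, ∀ a ∈ A, ψ a = c) := by
  by_cases h : ∀ c, ∃ v, ψ v = c ∧ φ v ≠ i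
  · choose v hvψ hvφ using h
    -- Containing `v c` keeps the set from lying inside φ-class `i`.
    have hB : ∀ c, ∃ B : Finset (Fin n), {v c} ⊆ B ∧ B ⊆ (univ.filter fun w => ψ w = c) ∧
        B.card = e := fun c =>
      exists_subsuperset_card_eq (by simpa using hvψ c) (by simp; omega) (hψ c)
    choose B hvB hBsub hBcard using hB
    have hBψ : ∀ c, ∀ a ∈ B c, ψ a = c := fun c a ha => by simpa using hBsub c ha
    obtain ⟨P, hQP, hP, hPC, hPF⟩ := exists_forcing_ePartition hk he hn heq hbig i (univ.image B)
      (card_image_le.trans (by simp))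
      (by
        intro A hA
        obtain ⟨c, -, rfl⟩ := mem_image.mp hA
        exact hBcard c)
      (by
        intro A hA A' hA' w hw hw'
        obtain ⟨c, -, rfl⟩ := mem_image.mp hA
        obtain ⟨d, -, rfl⟩ := mem_image.mp hA'
        rw [← hBψ c w hw, hBψ d w hw'])
      (by
        intro A hA
        obtain ⟨c, -, rfl⟩ := mem_image.mp hA
        exact ⟨v c, hvB c (mem_singleton_self _), hvφ c⟩)
    exact ⟨P, hP, hPC, hPF, fun _ c => ⟨B c, hQP (mem_image_of_mem _ (mem_univ _)), hBψ c⟩⟩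
  · obtain ⟨P, -, hP, hPC, hPF⟩ := exists_forcing_ePartition hk he hn heq hbig i ∅
      (by simp) (by simp) (by simp) (by simp)
    exact ⟨P, hP, hPC, hPF, fun h' => absurd h' h⟩

end EStarSystem

/-! ### The uniquely colourable system -/

theorem mainTheorem7 (k e : ℕ) (hk : 3 ≤ k) (he : 3 ≤ e)
    (h : ∃ n₀ : ℕ, n₀ ≡ 0 [MOD 2 * e] ∧ ∃ S : EStarSystem (Fin n₀) e,
      S.IsChromatic k ∧ S.HasStronglyEquitableColouring k) :
    ∃ n : ℕ, n ≡ 0 [MOD 2 * e] ∧ ∃ S : EStarSystem (Fin n) e,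
      S.IsChromatic k ∧ S.IsUniquelyColourable k ∧ S.HasStronglyEquitableColouring k := by
  classical
  obtain ⟨n₀, hn₀, S₀, ⟨-, hS₀⟩, φ₀, hφ₀, heq₀⟩ := h
  have hcopies := EStarSystem.exists_large_classes hk he ((Nat.modEq_zero_iff_dvd).mp hn₀) S₀ hS₀ φ₀
    hφ₀ heq₀
  obtain ⟨n, S, φ, hn, hφ, heq, hbig⟩ := hcopies (2 * k * e)
  let Ψ := {ψ : Fin n → Fin k // S.IsColouring ψ}
  have hΨ : Nonempty Ψ := ⟨⟨φ, hφ⟩⟩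
  obtain ⟨m, T, θ, hm, hθ, heqθ, hbigθ⟩ := hcopies (Fintype.card Ψ)
  have hlab : ∀ i, ∃ f : {x : Fin m // θ x = i} → Ψ, Function.Surjective f := by
    intro i
    obtain ⟨g⟩ := Function.Embedding.nonempty_of_card_le (α := Ψ) (β := {x : Fin m // θ x = i})
      (by rw [Fintype.card_subtype (fun x => θ x = i)]; exact hbigθ θ hθ i)
    exact ⟨Function.invFun g, Function.invFun_surjective g.injective⟩
  choose lab hlab using hlab
  have hpart := fun x : Fin m => EStarSystem.exists_blocking_ePartition hk he
    ((dvd_mul_left e 2).trans hn) heq (hbig φ hφ) (θ x) (lab (θ x) ⟨x, rfl⟩).1 fun c =>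
      (Nat.le_mul_of_pos_left e (by omega)).trans (hbig _ (lab (θ x) ⟨x, rfl⟩).2 c)
  choose p hp hpC hpF hpB using hpart
  obtain ⟨U, hU⟩ := EStarSystem.exists_glue T S p hp
  have hΦ : U.IsColouring (Fin.append θ φ) := by
    rw [hU, EStarSystem.append_comp_castAdd, EStarSystem.append_comp_natAdd]
    exact ⟨hθ, hφ, fun x A hA => by simpa using hpC x A hA⟩
  have hpos : 0 < 2 * k * e := by positivity
  refine ⟨m + n, (Nat.modEq_zero_iff_dvd).mpr (dvd_add hm hn), U, ⟨⟨_, hΦ⟩, ?_⟩,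
    ⟨_, hΦ, ?_⟩, _, hΦ, ?_⟩
  · rintro ⟨χ, hχ⟩
    obtain ⟨k, rfl⟩ : ∃ k', k = k' + 1 := ⟨k - 1, by omega⟩
    obtain ⟨-, hχS, -⟩ := (hU k χ).mp hχ
    -- Read as a colouring with one more colour, `χ` would have an empty last class.
    have := hbig (Fin.castSucc ∘ χ ∘ Fin.natAdd m)
      (fun B hB hmono => hχS B hB fun a ha => Fin.castSucc_injective _ (hmono a ha)) (Fin.last k)
    have h0 : EStarSystem.classCard (Fin.castSucc ∘ χ ∘ Fin.natAdd m) (Fin.last k) = 0 := by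
      simp [EStarSystem.classCard, Fin.castSucc_ne_last]
    omega
  · intro χ hχ
    obtain ⟨-, hχS, hχC⟩ := (hU k χ).mp hχ
    have hsurj : Function.Surjective (χ ∘ Fin.natAdd m) := by
      intro c
      obtain ⟨v, hv⟩ := card_pos.mp (lt_of_lt_of_le hpos (hbig _ hχS c))
      exact ⟨v, by simpa using hv⟩
    obtain ⟨σ, hσ⟩ : ∃ σ : Equiv.Perm (Fin k), χ ∘ Fin.natAdd m = σ ∘ φ := by
      refine EStarSystem.exists_perm_of_class_subset hsurj ?_
      by_contra! hcon
      obtain ⟨i, hi⟩ := hcon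
      -- `x` is labelled by the restriction of `χ` itself, so whatever colour `χ` gives `x`, a block
      -- at `x` is monochromatic.
      obtain ⟨⟨x, hx⟩, hlx⟩ := hlab i ⟨_, hχS⟩
      subst hx
      obtain ⟨A, hA, hAc⟩ := hpB x (by rw [hlx]; exact hi) (χ (Fin.castAdd n x))
      obtain ⟨a, ha, hne⟩ := hχC x A hA
      rw [hlx] at hAc
      exact hne (hAc a ha)
    refine ⟨σ, funext fun u => ?_⟩
    refine Fin.addCases (fun x => ?_) (fun y => ?_) u
    · by_contra hne
      have hne' : σ.symm (χ (Fin.castAdd n x)) ≠ θ x := by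
        intro heq'
        apply hne
        simp [← heq']
      -- If `x` had colour `σ c` with `c ≠ θ x`, its block inside φ-class `c` would be
      -- monochromatic.
      obtain ⟨A, hA, hAc⟩ := hpF x _ hne'
      obtain ⟨a, ha, hna⟩ := hχC x A hA
      apply hna
      have := congrFun hσ a
      simp only [Function.comp_apply] at this
      rw [this, hAc a ha, Equiv.apply_symm_apply]
    · simpa using congrFun hσ y
  · intro i j
    change EStarSystem.classCard _ i = EStarSystem.classCard _ j
    rw [EStarSystem.classCard_add, EStarSystem.classCard_add, EStarSystem.append_comp_castAdd,
      EStarSystem.append_comp_natAdd, heqθ i j, heq i j]
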